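/- **Theorem 5.1 (non-relativistic limit).** Let $\alpha\in(0,\pi/2)$ and $m>0$. For $c>0$ let $D_{0,c}$ be the operator in $L^2((0,\infty),\mathbb C^2)$ acting as $$D_{0,c}=\begin{pmatrix} mc^2 & -c\,\frac{d}{dx}\\ c\,\frac{d}{dx} & -mc^2\end{pmatrix},\qquad \operatorname{dom}(D_{0,c})=\Big\{\psi=\begin{pmatrix}\psi_1\\ \psi_2\end{pmatrix}\in H^1((0,\infty),\mathbb C^2):\ \psi_1(0)\,\frac{\cot\alpha}{mc}=\psi_2(0)\Big\},$$ and let $S_0$ be the Robin Laplacian in $L^2((0,\infty))$, $$S_0=-\frac1{2m}\frac{d^2}{dx^2},\qquad \operatorname{dom}(S_0)=\{\psi\in H^2((0,\infty)):\ \psi'(0)=\beta\,\psi(0)\},\qquad \beta=2\cot\alpha .$$ If $z\in\rho(S_0)$, then $z\in\rho(D_{0,c}-mc^2)$ for all sufficiently large $c$, and $$\lim_{c\to+\infty}\left\|(D_{0,c}-mc^2-z)^{-1}-\begin{pmatrix}(S_0-z)^{-1}&0\\0&0\end{pmatrix}\right\|=0,$$ where $\rho$ denotes the resolvent set and $\|\cdot\|$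 the operator norm on $L^2((0,\infty),\mathbb C^2)$. -/

import Mathlib

open MeasureTheory Set Filter Topology
open scoped ContDiff

noncomputable section

namespace NonRelLimit

/-! ### Unbounded operators: inverses, resolvent set, resolvent -/

section Operators

variable {H : Type*} [NormedAddCommGroup H] [NormedSpace ℂ H]

/-- The operator `A - w`, with the same domain as `A`. -/
def subScalar (A : H →ₗ.[ℂ] H) (w : ℂ) : H →ₗ.[ℂ] H where
  domain := A.domain
  toFun := A.toFun - w • A.domain.subtype

/-- `R` is a bounded, everywhere defined two-sided inverse of the unbounded operator `A`. -/
def IsBoundedInverse (A : H →ₗ.[ℂ] H) (R : H →L[ℂ] H) : Prop :=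
  (∀ f : H, ∃ h : R f ∈ A.domain, A ⟨R f, h⟩ = f) ∧
    ∀ u : A.domain, R (A u) = (u : H)

/-- A bounded inverse is unique. -/
theorem IsBoundedInverse.unique {A : H →ₗ.[ℂ] H} {R R' : H →L[ℂ] H}
    (h : IsBoundedInverse A R) (h' : IsBoundedInverse A R') : R = R' := by
  ext f
  obtain ⟨hd, he⟩ := h'.1 f
  have := h.2 ⟨R' f, hd⟩
  rwa [he] at this

/-- The resolvent set `ρ(A)`: all `z` such that `A - z` is a bijection from the domain of `A`
onto the whole space, with bounded inverse. -/
def resolventSet (A : H →ₗ.[ℂ] H) : Set ℂ :=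
  {z | ∃ R : H →L[ℂ] H, IsBoundedInverse (subScalar A z) R}

open Classical in
/-- The resolvent `(A - z)⁻¹` for `z ∈ ρ(A)` (and `0` for `z ∉ ρ(A)`). -/
def resolvent (A : H →ₗ.[ℂ] H) (z : ℂ) : H →L[ℂ] H :=
  if h : z ∈ resolventSet A then h.choose else 0

theorem resolvent_spec {A : H →ₗ.[ℂ] H} {z : ℂ} (h : z ∈ resolventSet A) :
    IsBoundedInverse (subScalar A z) (resolvent A z) := by
  rw [resolvent, dif_pos h]
  exact h.choose_spec

end Operators

/-! ### Function spaces on the half-line `(0, ∞)` -/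

/-- Lebesgue measure on `(0, ∞)`. -/
abbrev halfLine : Measure ℝ := volume.restrict (Ioi (0 : ℝ))

/-- `L²((0, ∞))`. -/
abbrev L2 : Type := Lp ℂ 2 halfLine

/-- `L²((0, ∞), ℂ²)`, where `ℂ²` carries its Euclidean norm. -/
abbrev L2Spinor : Type := Lp (EuclideanSpace ℂ (Fin 2)) 2 halfLine

/-- The component `ψ ↦ ψ i`, where `i = 0, 1` stands for the first and the second component. -/
def comp (i : Fin 2) : L2Spinor →L[ℂ] L2 :=
  (EuclideanSpace.proj i : EuclideanSpace ℂ (Fin 2) →L[ℂ] ℂ).compLpL 2 halfLine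

/-- The inclusion of `L²((0, ∞))` into `L²((0, ∞), ℂ²)` as the `i`-th component. -/
def incl (i : Fin 2) : L2 →L[ℂ] L2Spinor :=
  (ContinuousLinearMap.toSpanSingleton ℂ
    (EuclideanSpace.single i (1 : ℂ))).compLpL 2 halfLine

/-- The operator `diag(R, 0)` on `L²((0, ∞), ℂ²)`. -/
def diagZero (R : L2 →L[ℂ] L2) : L2Spinor →L[ℂ] L2Spinor :=
  (incl 0).comp (R.comp (comp 0))

/-- `g` is the weak derivative of `u` on `(0, ∞)`: it satisfies the integration by parts formula
against all `C^∞` functions with compact support in the open half-line. -/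
def HasWeakDeriv (u g : L2) : Prop :=
  ∀ φ : ℝ → ℝ, ContDiff ℝ ∞ φ → HasCompactSupport φ → tsupport φ ⊆ Ioi 0 →
    ∫ x in Ioi (0 : ℝ), deriv φ x • u x = -∫ x in Ioi (0 : ℝ), φ x • g x

theorem integrable_smul_L2 {φ : ℝ → ℝ} (hc : Continuous φ) (hs : HasCompactSupport φ)
    (u : L2) : Integrable (fun x => φ x • u x) halfLine := by
  have h1 : MemLp φ 2 halfLine := (hc.memLp_of_hasCompactSupport hs).restrict _
  exact memLp_one_iff_integrable.1 ((Lp.memLp u).smul h1)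

theorem HasWeakDeriv.add {u v g h : L2} (hu : HasWeakDeriv u g) (hv : HasWeakDeriv v h) :
    HasWeakDeriv (u + v) (g + h) := by
  intro φ hφ hs ht
  have hd : Continuous (deriv φ) := hφ.continuous_deriv (by simp)
  have e1 : ∫ x in Ioi (0 : ℝ), deriv φ x • (u + v : L2) x
      = ∫ x in Ioi (0 : ℝ), (deriv φ x • u x + deriv φ x • v x) := by
    refine integral_congr_ae ?_
    filter_upwards [Lp.coeFn_add u v] with x hx
    rw [hx, Pi.add_apply, smul_add]
  have e2 : ∫ x in Ioi (0 : ℝ), φ x • (g + h : L2) x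
      = ∫ x in Ioi (0 : ℝ), (φ x • g x + φ x • h x) := by
    refine integral_congr_ae ?_
    filter_upwards [Lp.coeFn_add g h] with x hx
    rw [hx, Pi.add_apply, smul_add]
  rw [e1, e2, integral_add (integrable_smul_L2 hd hs.deriv u) (integrable_smul_L2 hd hs.deriv v),
    integral_add (integrable_smul_L2 hφ.continuous hs g)
      (integrable_smul_L2 hφ.continuous hs h), hu φ hφ hs ht, hv φ hφ hs ht, neg_add]

theorem HasWeakDeriv.smul (k : ℂ) {u g : L2} (hu : HasWeakDeriv u g) :
    HasWeakDeriv (k • u) (k • g) := by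
  intro φ hφ hs ht
  have e1 : ∫ x in Ioi (0 : ℝ), deriv φ x • (k • u : L2) x
      = ∫ x in Ioi (0 : ℝ), k • (deriv φ x • u x) := by
    refine integral_congr_ae ?_
    filter_upwards [Lp.coeFn_smul k u] with x hx
    rw [hx, Pi.smul_apply, smul_comm]
  have e2 : ∫ x in Ioi (0 : ℝ), φ x • (k • g : L2) x
      = ∫ x in Ioi (0 : ℝ), k • (φ x • g x) := by
    refine integral_congr_ae ?_
    filter_upwards [Lp.coeFn_smul k g] with x hx
    rw [hx, Pi.smul_apply, smul_comm]
  rw [e1, e2, integral_smul, integral_smul, hu φ hφ hs ht, smul_neg]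

theorem HasWeakDeriv.zero : HasWeakDeriv 0 0 := by
  intro φ _ _ _
  have e (ψ : ℝ → ℝ) : ∫ x in Ioi (0 : ℝ), ψ x • (0 : L2) x = 0 := by
    rw [integral_congr_ae (g := fun _ => (0 : ℂ)), integral_zero]
    filter_upwards [Lp.coeFn_zero ℂ 2 halfLine] with x hx
    rw [hx, Pi.zero_apply, smul_zero]
  rw [e, e, neg_zero]

/-- The weak derivative is unique. -/
theorem HasWeakDeriv.unique {u g h : L2} (hg : HasWeakDeriv u g) (hh : HasWeakDeriv u h) :
    g = h := by
  have key : ∀ᵐ x ∂(volume : Measure ℝ), x ∈ Ioi (0 : ℝ) → g x - h x = 0 := by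
    refine isOpen_Ioi.ae_eq_zero_of_integral_contDiff_smul_eq_zero ?_ ?_
    · have hl (w : L2) : LocallyIntegrableOn w (Ioi (0 : ℝ)) volume := by
        have : LocallyIntegrable w halfLine := (Lp.memLp w).locallyIntegrable (by norm_num)
        exact locallyIntegrableOn_of_locallyIntegrable_restrict this
      exact (hl g).sub (hl h)
    · intro φ hφ hs ht
      have e0 : ∫ x, φ x • (g x - h x) = ∫ x in Ioi (0 : ℝ), φ x • (g x - h x) := by
        symm
        refine setIntegral_eq_integral_of_forall_compl_eq_zero fun x hx => ?_
        rw [image_eq_zero_of_notMem_tsupport fun hx' => hx (ht hx'), zero_smul]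
      rw [e0]
      simp only [smul_sub]
      rw [integral_sub (integrable_smul_L2 hφ.continuous hs g)
        (integrable_smul_L2 hφ.continuous hs h), sub_eq_zero]
      exact neg_injective ((hg φ hφ hs ht).symm.trans (hh φ hφ hs ht))
  refine Lp.ext ?_
  have := (ae_restrict_iff' (μ := volume) measurableSet_Ioi).2 key
  filter_upwards [this] with x hx
  exact sub_eq_zero.1 hx

/-- The Sobolev space `H¹((0, ∞))`. -/
def sobolevH1 : Submodule ℂ L2 where
  carrier := {u | ∃ g : L2, HasWeakDeriv u g}
  add_mem' := by
    rintro _ _ ⟨g, hg⟩ ⟨h, hh⟩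
    exact ⟨_, hg.add hh⟩
  zero_mem' := ⟨0, HasWeakDeriv.zero⟩
  smul_mem' := by
    rintro k _ ⟨g, hg⟩
    exact ⟨_, hg.smul k⟩

/-- The weak derivative `u ↦ u'` from `H¹((0, ∞))` to `L²((0, ∞))`. -/
def weakDeriv : sobolevH1 →ₗ[ℂ] L2 where
  toFun u := u.2.choose
  map_add' u v := (u + v).2.choose_spec.unique (u.2.choose_spec.add v.2.choose_spec)
  map_smul' k u := (k • u).2.choose_spec.unique (u.2.choose_spec.smul k)

theorem weakDeriv_spec (u : sobolevH1) : HasWeakDeriv (u : L2) (weakDeriv u) :=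
  u.2.choose_spec

/-- The Sobolev space `H²((0, ∞))`: all `u ∈ H¹((0, ∞))` with `u' ∈ H¹((0, ∞))`. -/
def sobolevH2 : Submodule ℂ L2 := (sobolevH1.comap weakDeriv).map sobolevH1.subtype

theorem sobolevH2_le : sobolevH2 ≤ sobolevH1 := Submodule.map_subtype_le _ _

/-- The weak derivative as a map from `H²((0, ∞))` to `H¹((0, ∞))`. -/
def weakDerivH2 : sobolevH2 →ₗ[ℂ] sobolevH1 :=
  (weakDeriv ∘ₗ Submodule.inclusion sobolevH2_le).codRestrict sobolevH1 fun u => by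
    obtain ⟨v, hv, e⟩ := u.2
    have : Submodule.inclusion sobolevH2_le u = v := Subtype.ext e.symm
    rw [LinearMap.comp_apply, this]
    exact hv

/-- `u(0) = a` in the sense of traces: `u` has a representative that is continuous on `[0, ∞)`
and takes the value `a` at `0`. -/
def HasTrace (u : L2) (a : ℂ) : Prop :=
  ∃ v : ℝ → ℂ, ContinuousOn v (Ici 0) ∧ u =ᵐ[halfLine] v ∧ v 0 = a

theorem HasTrace.add {u v : L2} {a b : ℂ} (hu : HasTrace u a) (hv : HasTrace v b) :
    HasTrace (u + v) (a + b) := by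
  obtain ⟨p, hp, hpu, rfl⟩ := hu
  obtain ⟨q, hq, hqv, rfl⟩ := hv
  exact ⟨p + q, hp.add hq, (Lp.coeFn_add u v).trans (hpu.add hqv), rfl⟩

theorem HasTrace.smul (k : ℂ) {u : L2} {a : ℂ} (hu : HasTrace u a) :
    HasTrace (k • u) (k * a) := by
  obtain ⟨p, hp, hpu, rfl⟩ := hu
  exact ⟨k • p, hp.const_smul k, (Lp.coeFn_smul k u).trans (hpu.const_smul k), rfl⟩

theorem HasTrace.zero : HasTrace 0 0 :=
  ⟨0, continuousOn_const, Lp.coeFn_zero _ _ _, rfl⟩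

/-! ### The Dirac operator and the Robin Laplacian -/

/-- The domain of `D_{0,c}`: all `ψ ∈ H¹((0, ∞), ℂ²)` with `ψ₁(0) cot(α) / (m c) = ψ₂(0)`. -/
def diracDomain (α m c : ℝ) : Submodule ℂ L2Spinor where
  carrier := {ψ | comp 0 ψ ∈ sobolevH1 ∧ comp 1 ψ ∈ sobolevH1 ∧
    ∃ a b : ℂ, HasTrace (comp 0 ψ) a ∧ HasTrace (comp 1 ψ) b ∧
      a * ((Real.cot α / (m * c) : ℝ) : ℂ) = b}
  add_mem' := by
    rintro ψ χ ⟨h0, h1, a, b, ha, hb, e⟩ ⟨h0', h1', a', b', ha', hb', e'⟩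
    simp only [mem_ofPred_eq, map_add]
    exact ⟨add_mem h0 h0', add_mem h1 h1', a + a', b + b', ha.add ha', hb.add hb',
      by rw [add_mul, e, e']⟩
  zero_mem' := by
    simp only [mem_ofPred_eq, map_zero]
    exact ⟨zero_mem _, zero_mem _, 0, 0, HasTrace.zero, HasTrace.zero, zero_mul _⟩
  smul_mem' := by
    rintro k ψ ⟨h0, h1, a, b, ha, hb, e⟩
    simp only [mem_ofPred_eq, map_smul]
    exact ⟨Submodule.smul_mem _ _ h0, Submodule.smul_mem _ _ h1, k * a, k * b,
      ha.smul k, hb.smul k, by rw [mul_assoc, e]⟩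

/-- The `i`-th component of an element of the domain of `D_{0,c}`, as an element of `H¹`. -/
def diracComp (α m c : ℝ) (i : Fin 2) : diracDomain α m c →ₗ[ℂ] sobolevH1 :=
  ((comp i).toLinearMap ∘ₗ (diracDomain α m c).subtype).codRestrict sobolevH1 fun ψ => by
    fin_cases i
    · exact ψ.2.1
    · exact ψ.2.2.1

/-- The Dirac operator `D_{0,c}` in `L²((0, ∞), ℂ²)`:
`(D_{0,c} ψ)₁ = m c² ψ₁ - c ψ₂'` and `(D_{0,c} ψ)₂ = c ψ₁' - m c² ψ₂`. -/
def dirac (α m c : ℝ) : L2Spinor →ₗ.[ℂ] L2Spinor where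
  domain := diracDomain α m c
  toFun :=
    (incl 0).toLinearMap ∘ₗ
        (((m * c ^ 2 : ℝ) : ℂ) • (sobolevH1.subtype ∘ₗ diracComp α m c 0)
          - (c : ℂ) • (weakDeriv ∘ₗ diracComp α m c 1))
      + (incl 1).toLinearMap ∘ₗ
        ((c : ℂ) • (weakDeriv ∘ₗ diracComp α m c 0)
          - ((m * c ^ 2 : ℝ) : ℂ) • (sobolevH1.subtype ∘ₗ diracComp α m c 1))

/-- Those `u ∈ H²((0, ∞))` that satisfy the boundary condition `u'(0) = β u(0)`. -/
def robinCondition (β : ℝ) : Submodule ℂ sobolevH2 where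
  carrier := {u | ∃ a b : ℂ, HasTrace (u : L2) a ∧ HasTrace (weakDerivH2 u : L2) b ∧
    b = (β : ℂ) * a}
  add_mem' := by
    rintro u v ⟨a, b, ha, hb, e⟩ ⟨a', b', ha', hb', e'⟩
    refine ⟨a + a', b + b', ha.add ha', ?_, by rw [e, e', mul_add]⟩
    rw [map_add]
    exact hb.add hb'
  zero_mem' := by
    refine ⟨0, 0, HasTrace.zero, ?_, by rw [mul_zero]⟩
    rw [map_zero]
    exact HasTrace.zero
  smul_mem' := by
    rintro k u ⟨a, b, ha, hb, e⟩
    refine ⟨k * a, k * b, ha.smul k, ?_, by rw [e, mul_left_comm]⟩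
    rw [map_smul]
    exact hb.smul k

/-- The domain of the Robin Laplacian: all `ψ ∈ H²((0, ∞))` with `ψ'(0) = β ψ(0)`. -/
def robinDomain (β : ℝ) : Submodule ℂ L2 := (robinCondition β).map sobolevH2.subtype

theorem robinDomain_le (β : ℝ) : robinDomain β ≤ sobolevH2 := Submodule.map_subtype_le _ _

/-- The Robin Laplacian `S₀ = -(1 / (2m)) d²/dx²` in `L²((0, ∞))`
with the boundary condition `ψ'(0) = β ψ(0)`. -/
def robin (m β : ℝ) : L2 →ₗ.[ℂ] L2 where
  domain := robinDomain β
  toFun := (-((1 / (2 * m) : ℝ) : ℂ)) •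
    (weakDeriv ∘ₗ weakDerivH2 ∘ₗ Submodule.inclusion (robinDomain_le β))

end NonRelLimit

end

noncomputable section

namespace NonRelLimit

/-! ### Convolution with a decaying exponential on the half-line -/

/-! With W = diag(1, 1/c), multiplying the second component by c gives (D_{0,c} - mc² - z)⁻¹ = W
(D_{0,1} - diag(m+z, m+z/c²))⁻¹ W. The rescaled boundary condition v(0) = (cot α / m) u(0) no longer
involves c. What is left of c is the bounded perturbation diag(0, z/c²), which tends to 0, and the
factors W, which tend to diag(1, 0) (`IsInverseSub.rescale`). It therefore suffices to invert the
formal limit D_{0,1} - diag(m+z, m) by a bounded operator X with diag(1,0) X diag(1,0) = diag((S₀ -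
z)⁻¹, 0); a Neumann argument (`IsInverseSub.add`) does the rest in operator norm.

The limit equation is -v' - zu = f, u' - 2mv = g. Eliminating v directly would differentiate g,
which is only in L². Instead let p solve p' + 2mp = g, p(0) = 0, and put u = p + r, v = r'/(2m) - p.
The second equation then holds identically, the first becomes (S₀ - z) r = f - g + (2m+z) p, and
since p(0) = 0 the boundary condition becomes r'(0) = 2 cot α · r(0). So r comes from the Robin
resolvent (`exists_isInverseSub_dirac`). The map g ↦ p is convolution with a decaying exponential,
bounded on L² by Schur's test; f ↦ r' is bounded by the closed graph theorem. -/

/-- Integration by parts for the primitive of a locally integrable function. -/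
theorem integral_deriv_smul_primitive {G : ℝ → ℂ} (hG : LocallyIntegrable G) {χ : ℝ → ℝ}
    (hχ : ContDiff ℝ 1 χ) (hs : HasCompactSupport χ) :
    ∫ x in Ioi (0 : ℝ), deriv χ x • (∫ t in (0 : ℝ)..x, G t)
      = -∫ x in Ioi (0 : ℝ), χ x • G x := by
  obtain ⟨T, hT⟩ : ∃ T : ℝ, ∀ x, T < x → χ x = 0 := by
    obtain ⟨T, hT⟩ := hs.isCompact.bddAbove
    exact ⟨T, fun x hx => image_eq_zero_of_notMem_tsupport fun h => hx.not_ge (hT h)⟩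
  have hT' : ∀ x, T < x → deriv χ x = 0 := fun x hx => by
    have : χ =ᶠ[𝓝 x] fun _ => 0 := by
      filter_upwards [Ioi_mem_nhds hx] with y hy using hT y hy
    rw [this.deriv_eq, deriv_const]
  have hGT : IntegrableOn G (Ioc 0 T) := (hG.integrableOn_isCompact isCompact_Icc).mono_set
    Ioc_subset_Icc_self
  have hdc : Continuous (deriv χ) := hχ.continuous_deriv le_rfl
  have hd : Integrable (deriv χ) halfLine :=
    (hdc.integrable_of_hasCompactSupport hs.deriv).restrict
  -- The primitive is written as an integral over the triangle 0 < t < x. Cutting t off at T is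
  -- harmless because χ' vanishes beyond T, and it makes the integrand integrable on the product, so
  -- Fubini applies.
  have e1 : ∫ x in Ioi (0 : ℝ), deriv χ x • (∫ t in (0 : ℝ)..x, G t)
      = ∫ x in Ioi (0 : ℝ), ∫ t in Ioc 0 T,
        {p : ℝ × ℝ | p.2 < p.1}.indicator (fun p => deriv χ p.1 • G p.2) (x, t) := by
    refine setIntegral_congr_fun measurableSet_Ioi fun x hx => ?_
    rcases lt_or_ge T x with h | h
    · simp [indicator, hT' x h]
    · rw [intervalIntegral.integral_of_le (le_of_lt hx), integral_Ioc_eq_integral_Ioo,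
        ← integral_smul]
      have : ∀ t, {p : ℝ × ℝ | p.2 < p.1}.indicator (fun p => deriv χ p.1 • G p.2) (x, t)
          = (Iio x).indicator (fun t => deriv χ x • G t) t := fun t => by
        simp [indicator]
      simp only [this]
      rw [setIntegral_indicator measurableSet_Iio]
      congr 2
      ext t
      simp only [mem_Ioo, mem_inter_iff, mem_Ioc, mem_Iio]
      exact ⟨fun ⟨a, b⟩ => ⟨⟨a, (b.trans_le h).le⟩, b⟩, fun ⟨⟨a, _⟩, b⟩ => ⟨a, b⟩⟩
  have hint : Integrable (Function.uncurry fun x t : ℝ =>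
      {p : ℝ × ℝ | p.2 < p.1}.indicator (fun p => deriv χ p.1 • G p.2) (x, t))
      (halfLine.prod (volume.restrict (Ioc 0 T))) :=
    (hd.smul_prod hGT).indicator (measurableSet_lt measurable_snd measurable_fst)
  rw [e1, integral_integral_swap hint]
  have e2 : ∀ t ∈ Ioc 0 T, ∫ x in Ioi (0 : ℝ),
      {p : ℝ × ℝ | p.2 < p.1}.indicator (fun p => deriv χ p.1 • G p.2) (x, t)
        = -(χ t • G t) := by
    intro t ht
    have : ∀ x, {p : ℝ × ℝ | p.2 < p.1}.indicator (fun p => deriv χ p.1 • G p.2) (x, t)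
          = (Ioi t).indicator (fun x => deriv χ x • G t) x := fun x => by
        simp [indicator]
    simp only [this]
    rw [setIntegral_indicator measurableSet_Ioi, Ioi_inter_Ioi, sup_eq_right.2 ht.1.le,
      integral_smul_const, hs.integral_Ioi_deriv_eq hχ, neg_smul]
  rw [setIntegral_congr_fun measurableSet_Ioc e2, integral_neg]
  congr 1
  refine (setIntegral_eq_of_subset_of_forall_sdiff_eq_zero measurableSet_Ioi
    Ioc_subset_Ioi_self fun x hx => ?_).symm
  have : T < x := by
    by_contra h
    exact hx.2 ⟨hx.1, not_lt.1 h⟩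
  rw [hT x this, zero_smul]

/-- The function `s ↦ e^{-μ s}` on `(0, ∞)`, extended by zero. -/
def decay (μ : ℝ) : ℝ → ℝ := (Ioi (0 : ℝ)).indicator fun s => Real.exp (-μ * s)

theorem measurable_decay (μ : ℝ) : Measurable (decay μ) :=
  (by fun_prop : Measurable fun s : ℝ => Real.exp (-μ * s)).indicator measurableSet_Ioi

theorem lintegral_decay_lt_top {μ : ℝ} (hμ : 0 < μ) : ∫⁻ s, ‖decay μ s‖ₑ < ⊤ :=
  ((integrable_indicator_iff measurableSet_Ioi).2 (exp_neg_integrableOn_Ioi 0 hμ)).2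

/-- The function `x ↦ ∫₀ˣ e^{-μ (x - t)} f(t) dt`. -/
def decayConv (μ : ℝ) (f : ℝ → ℂ) (x : ℝ) : ℂ := ∫ t in Ioi (0 : ℝ), decay μ (x - t) • f t

theorem locallyIntegrable_exp_smul (μ : ℝ) (f : L2) :
    LocallyIntegrable fun t => Real.exp (μ * t) • (Ioi (0 : ℝ)).indicator f t := by
  have h : MemLp ((Ioi (0 : ℝ)).indicator f) 2 volume :=
    (memLp_indicator_iff_restrict measurableSet_Ioi).2 (Lp.memLp f)
  have hc : Continuous fun t : ℝ => Real.exp (μ * t) := by fun_prop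
  exact LocallyIntegrable.continuous_smul (𝕜 := ℝ) hc (h.locallyIntegrable (by norm_num))

/-- Splitting e^{-μ(x-t)} = e^{-μx} e^{μt} for t < x turns the convolution into a smooth factor
times a primitive; continuity, the value at 0 and the weak derivative all come from this form. -/
theorem decay_smul_eq (μ x : ℝ) (f : ℝ → ℂ) {t : ℝ} (ht : t ∈ Ioi (0 : ℝ)) :
    decay μ (x - t) • f t = (Iio x).indicator (fun t =>
      Real.exp (-μ * x) • Real.exp (μ * t) • (Ioi (0 : ℝ)).indicator f t) t := by
  by_cases h : t < x
  · rw [indicator_of_mem (by exact h), indicator_of_mem ht, decay,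
      indicator_of_mem (by simpa using h), smul_smul, ← Real.exp_add]
    ring_nf
  · rw [indicator_of_notMem (by exact h), decay, indicator_of_notMem (by simpa using h), zero_smul]

theorem integrable_decay_smul (μ x : ℝ) (f : L2) :
    Integrable (fun t => decay μ (x - t) • f t) halfLine := by
  refine IntegrableOn.congr_fun ?_ (fun t ht => (decay_smul_eq μ x f ht).symm) measurableSet_Ioi
  refine (integrable_indicator_iff measurableSet_Iio).2 ?_
  rw [IntegrableOn, Measure.restrict_restrict measurableSet_Iio]
  refine Integrable.smul (Real.exp (-μ * x)) ?_
  exact ((locallyIntegrable_exp_smul μ f).integrableOn_isCompact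
    (isCompact_Icc (a := 0) (b := x))).mono_set fun t ht => ⟨le_of_lt ht.2, le_of_lt ht.1⟩

theorem decayConv_eq (μ : ℝ) (f : ℝ → ℂ) {x : ℝ} (hx : 0 ≤ x) :
    decayConv μ f x = Real.exp (-μ * x) •
      ∫ t in (0 : ℝ)..x, Real.exp (μ * t) • (Ioi (0 : ℝ)).indicator f t := by
  rw [decayConv, setIntegral_congr_fun measurableSet_Ioi fun t ht => decay_smul_eq μ x f ht,
    setIntegral_indicator measurableSet_Iio, Ioi_inter_Iio, integral_smul,
    intervalIntegral.integral_of_le hx, integral_Ioc_eq_integral_Ioo]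

theorem continuousOn_decayConv (μ : ℝ) (f : L2) : ContinuousOn (decayConv μ f) (Ici 0) := by
  have h : Continuous fun x : ℝ => ∫ t in (0 : ℝ)..x,
      Real.exp (μ * t) • (Ioi (0 : ℝ)).indicator f t :=
    intervalIntegral.continuous_primitive
      (fun a b => ((locallyIntegrable_exp_smul μ f).integrableOn_isCompact
        isCompact_uIcc).intervalIntegrable) 0
  refine ContinuousOn.congr (f := fun x : ℝ => Real.exp (-μ * x) • ∫ t in (0 : ℝ)..x,
      Real.exp (μ * t) • (Ioi (0 : ℝ)).indicator f t) ?_ fun x hx => decayConv_eq μ f hx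
  exact (by fun_prop : Continuous fun x : ℝ => Real.exp (-μ * x)).smul h |>.continuousOn

/-- Cauchy–Schwarz after writing the kernel as the product of its two square roots, one of them kept
with f. This is the pointwise half of Schur's test; integrating in x gives the other half. -/
theorem enorm_decayConv_sq_le (μ : ℝ) (f : L2) (x : ℝ) :
    ‖decayConv μ f x‖ₑ ^ (2 : ℝ) ≤ (∫⁻ s, ‖decay μ s‖ₑ) *
      ∫⁻ t in Ioi (0 : ℝ), ‖decay μ (x - t)‖ₑ * ‖f t‖ₑ ^ (2 : ℝ) := by
  have hm : Measurable fun t : ℝ => ‖decay μ (x - t)‖ₑ :=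
    ((measurable_decay μ).comp (measurable_const.sub measurable_id)).enorm
  have hf : AEMeasurable (fun t => ‖f t‖ₑ) halfLine := (Lp.aestronglyMeasurable f).enorm
  have h1 : ‖decayConv μ f x‖ₑ ≤ ∫⁻ t in Ioi (0 : ℝ),
      ((fun t => ‖decay μ (x - t)‖ₑ ^ (1 / 2 : ℝ)) *
        fun t => ‖decay μ (x - t)‖ₑ ^ (1 / 2 : ℝ) * ‖f t‖ₑ) t := by
    refine (enorm_integral_le_lintegral_enorm _).trans_eq (lintegral_congr fun t => ?_)
    rw [Pi.mul_apply, ← mul_assoc, ← ENNReal.rpow_add_of_nonneg _ _ (by norm_num) (by norm_num),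
      enorm_smul]
    norm_num
  have h2 := h1.trans (ENNReal.lintegral_mul_le_Lp_mul_Lq halfLine Real.HolderConjugate.two_two
    (hm.pow_const _).aemeasurable ((hm.pow_const _).aemeasurable.mul hf))
  refine (ENNReal.rpow_le_rpow h2 (by norm_num : (0 : ℝ) ≤ 2)).trans ?_
  rw [ENNReal.mul_rpow_of_nonneg _ _ (by norm_num), ← ENNReal.rpow_mul, ← ENNReal.rpow_mul]
  norm_num only [ENNReal.rpow_one]
  gcongr ?_ * ?_
  · calc _ = ∫⁻ t in Ioi (0 : ℝ), ‖decay μ (x - t)‖ₑ := by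
          refine lintegral_congr fun t => ?_
          rw [← ENNReal.rpow_mul]; norm_num
      _ ≤ ∫⁻ t, ‖decay μ (x - t)‖ₑ := setLIntegral_le_lintegral _ _
      _ = _ := lintegral_sub_left_eq_self (fun s => ‖decay μ s‖ₑ) x
  · refine lintegral_mono fun t => ?_
    rw [ENNReal.mul_rpow_of_nonneg _ _ (by norm_num), ← ENNReal.rpow_mul]
    norm_num

/-- Schur's test for `f ↦ decayConv μ f`. -/
theorem eLpNorm_decayConv_le (μ : ℝ) (f : L2) :
    eLpNorm (decayConv μ f) 2 halfLine ≤ (∫⁻ s, ‖decay μ s‖ₑ) * eLpNorm f 2 halfLine := by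
  set C := ∫⁻ s, ‖decay μ s‖ₑ with hC
  have hf : AEMeasurable (fun t => ‖f t‖ₑ) halfLine := (Lp.aestronglyMeasurable f).enorm
  have hk : Measurable fun p : ℝ × ℝ => ‖decay μ (p.1 - p.2)‖ₑ :=
    ((measurable_decay μ).comp (measurable_fst.sub measurable_snd)).enorm
  have hmeas : AEMeasurable (Function.uncurry fun x t : ℝ =>
      ‖decay μ (x - t)‖ₑ * ‖f t‖ₑ ^ (2 : ℝ)) (halfLine.prod halfLine) :=
    hk.aemeasurable.mul (hf.pow_const _).comp_snd
  have key : ∫⁻ x in Ioi (0 : ℝ), ‖decayConv μ f x‖ₑ ^ (2 : ℝ)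
      ≤ C ^ (2 : ℝ) * ∫⁻ t in Ioi (0 : ℝ), ‖f t‖ₑ ^ (2 : ℝ) := by
    calc _ ≤ ∫⁻ x in Ioi (0 : ℝ), C *
          ∫⁻ t in Ioi (0 : ℝ), ‖decay μ (x - t)‖ₑ * ‖f t‖ₑ ^ (2 : ℝ) :=
          lintegral_mono fun x => enorm_decayConv_sq_le μ f x
      _ = C * ∫⁻ x in Ioi (0 : ℝ), ∫⁻ t in Ioi (0 : ℝ),
          ‖decay μ (x - t)‖ₑ * ‖f t‖ₑ ^ (2 : ℝ) :=
          lintegral_const_mul'' _ hmeas.lintegral_prod_right'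
      _ = C * ∫⁻ t in Ioi (0 : ℝ), ∫⁻ x in Ioi (0 : ℝ),
          ‖decay μ (x - t)‖ₑ * ‖f t‖ₑ ^ (2 : ℝ) := by rw [lintegral_lintegral_swap hmeas]
      _ ≤ C * ∫⁻ t in Ioi (0 : ℝ), C * ‖f t‖ₑ ^ (2 : ℝ) := by
          gcongr with t
          have hkt : Measurable fun x : ℝ => ‖decay μ (x - t)‖ₑ :=
            hk.comp (measurable_id.prodMk measurable_const)
          rw [lintegral_mul_const _ hkt]
          gcongr
          exact (setLIntegral_le_lintegral _ _).trans_eq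
            (lintegral_sub_right_eq_self (fun s => ‖decay μ s‖ₑ) t)
      _ = _ := by
          rw [lintegral_const_mul'' _ (hf.pow_const _), ← mul_assoc, ENNReal.rpow_two, sq]
  rw [eLpNorm_eq_lintegral_rpow_enorm_toReal (by norm_num) (by norm_num),
    eLpNorm_eq_lintegral_rpow_enorm_toReal (by norm_num) (by norm_num), ENNReal.toReal_ofNat]
  refine (ENNReal.rpow_le_rpow key (by norm_num)).trans_eq ?_
  rw [ENNReal.mul_rpow_of_nonneg _ _ (by norm_num), ← ENNReal.rpow_mul]
  norm_num

theorem memLp_decayConv {μ : ℝ} (hμ : 0 < μ) (f : L2) : MemLp (decayConv μ f) 2 halfLine :=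
  ⟨((continuousOn_decayConv μ f).mono Ioi_subset_Ici_self).aestronglyMeasurable measurableSet_Ioi,
    (eLpNorm_decayConv_le μ f).trans_lt
      (ENNReal.mul_lt_top (lintegral_decay_lt_top hμ) (Lp.memLp f).2)⟩

theorem decayConv_add (μ : ℝ) (f g : L2) :
    decayConv μ (f + g : L2) = decayConv μ f + decayConv μ g := by
  ext x
  rw [Pi.add_apply, decayConv, decayConv, decayConv,
    ← integral_add (integrable_decay_smul μ x f) (integrable_decay_smul μ x g)]
  refine integral_congr_ae ?_
  filter_upwards [Lp.coeFn_add f g] with t ht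
  rw [ht, Pi.add_apply, smul_add]

theorem decayConv_smul (μ : ℝ) (k : ℂ) (f : L2) :
    decayConv μ (k • f : L2) = k • decayConv μ f := by
  ext x
  rw [Pi.smul_apply, decayConv, decayConv, ← integral_smul]
  refine integral_congr_ae ?_
  filter_upwards [Lp.coeFn_smul k f] with t ht
  rw [ht, Pi.smul_apply, smul_comm]

/-- The operator `f ↦ ∫₀ˣ e^{-μ (x - t)} f(t) dt` on `L²((0, ∞))`, which inverts `d/dx + μ` with
the boundary condition `u(0) = 0`. -/
def decayOp {μ : ℝ} (hμ : 0 < μ) : L2 →L[ℂ] L2 :=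
  LinearMap.mkContinuous
    { toFun f := (memLp_decayConv hμ f).toLp
      map_add' f g := by
        rw [← MemLp.toLp_add]
        exact MemLp.toLp_congr _ _ (.of_forall fun x => congrFun (decayConv_add μ f g) x)
      map_smul' k f := by
        rw [RingHom.id_apply, ← MemLp.toLp_const_smul]
        exact MemLp.toLp_congr _ _ (.of_forall fun x => congrFun (decayConv_smul μ k f) x) }
    (∫⁻ s, ‖decay μ s‖ₑ).toReal fun f => by
      rw [LinearMap.coe_mk, AddHom.coe_mk, Lp.norm_toLp, Lp.norm_def, ← ENNReal.toReal_mul]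
      exact ENNReal.toReal_mono
        (ENNReal.mul_lt_top (lintegral_decay_lt_top hμ) (Lp.memLp f).2).ne
        (eLpNorm_decayConv_le μ f)

theorem decayOp_coeFn {μ : ℝ} (hμ : 0 < μ) (f : L2) :
    decayOp hμ f =ᵐ[halfLine] decayConv μ f :=
  MemLp.coeFn_toLp (memLp_decayConv hμ f)

theorem hasTrace_decayOp {μ : ℝ} (hμ : 0 < μ) (f : L2) : HasTrace (decayOp hμ f) 0 :=
  ⟨decayConv μ f, continuousOn_decayConv μ f, decayOp_coeFn hμ f, by
    rw [decayConv_eq μ f le_rfl, intervalIntegral.integral_same, smul_zero]⟩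

/-- Up to the factor e^{-μx} the function is a primitive of e^{μt} f(t), so the formula is
integration by parts against the test function φ(x) e^{-μx}; differentiating the exponential
produces the term -μ. -/
theorem hasWeakDeriv_decayOp {μ : ℝ} (hμ : 0 < μ) (f : L2) :
    HasWeakDeriv (decayOp hμ f) (f - (μ : ℂ) • decayOp hμ f) := by
  intro φ hφ hs ht
  have hφ1 : ContDiff ℝ 1 φ := hφ.of_le (by exact_mod_cast le_top)
  have hexp : ContDiff ℝ 1 fun x : ℝ => Real.exp (-μ * x) := by fun_prop
  have hd : Continuous (deriv φ) := hφ1.continuous_deriv le_rfl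
  have key := integral_deriv_smul_primitive (locallyIntegrable_exp_smul μ f)
    (χ := φ * fun x => Real.exp (-μ * x)) (hφ1.mul hexp) hs.mul_right
  have e1 : ∫ x in Ioi (0 : ℝ), deriv (φ * fun x => Real.exp (-μ * x)) x •
      (∫ t in (0 : ℝ)..x, Real.exp (μ * t) • (Ioi (0 : ℝ)).indicator f t)
      = ∫ x in Ioi (0 : ℝ), (deriv φ x • decayOp hμ f x - μ • φ x • decayOp hμ f x) := by
    refine integral_congr_ae ?_
    filter_upwards [decayOp_coeFn hμ f, ae_restrict_mem measurableSet_Ioi] with x hx hx0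
    have hE : HasDerivAt (fun x : ℝ => Real.exp (-μ * x)) (Real.exp (-μ * x) * -μ) x := by
      simpa using ((hasDerivAt_id x).const_mul (-μ)).exp
    rw [hx, decayConv_eq μ f (le_of_lt hx0),
      ((hφ1.differentiable one_ne_zero x).hasDerivAt.mul hE).deriv]
    simp only [smul_smul, ← sub_smul]
    congr 1
    ring
  have e2 : ∫ x in Ioi (0 : ℝ), (φ * fun x => Real.exp (-μ * x)) x •
      Real.exp (μ * x) • (Ioi (0 : ℝ)).indicator f x = ∫ x in Ioi (0 : ℝ), φ x • f x := by
    refine setIntegral_congr_fun measurableSet_Ioi fun x hx => ?_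
    simp only [Pi.mul_apply, indicator_of_mem hx, smul_smul, mul_assoc, ← Real.exp_add]
    simp
  have e3 : ∫ x in Ioi (0 : ℝ), φ x • (f - (μ : ℂ) • decayOp hμ f : L2) x
      = ∫ x in Ioi (0 : ℝ), (φ x • f x - μ • φ x • decayOp hμ f x) := by
    refine integral_congr_ae ?_
    filter_upwards [Lp.coeFn_sub f ((μ : ℂ) • decayOp hμ f),
      Lp.coeFn_smul (μ : ℂ) (decayOp hμ f)] with x h1 h2
    rw [h1, Pi.sub_apply, h2, Pi.smul_apply, smul_sub, smul_comm μ, Complex.coe_smul]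
  have i1 := integrable_smul_L2 hd hs.deriv (decayOp hμ f)
  have i2 : Integrable (fun x => μ • φ x • decayOp hμ f x) halfLine :=
    (integrable_smul_L2 hφ.continuous hs (decayOp hμ f)).smul μ
  have i3 := integrable_smul_L2 hφ.continuous hs f
  rw [e1, e2, integral_sub i1 i2] at key
  rw [e3, integral_sub i3 i2, sub_eq_iff_eq_add.1 key]
  abel

/-! ### Bounded perturbations of unbounded operators -/

section Perturbation

variable {H : Type*} [NormedAddCommGroup H] [NormedSpace ℂ H]

/-- `R` is a bounded, everywhere defined two-sided inverse of `A - B`, with `B` bounded. -/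
def IsInverseSub (A : H →ₗ.[ℂ] H) (B R : H →L[ℂ] H) : Prop :=
  (∀ f, (R f, f + B (R f)) ∈ A.graph) ∧ ∀ u g, (u, g) ∈ A.graph → R (g - B u) = u

theorem mem_graph_subScalar {A : H →ₗ.[ℂ] H} {w : ℂ} {u f : H} :
    (u, f) ∈ (subScalar A w).graph ↔ (u, f + w • u) ∈ A.graph := by
  simp only [LinearPMap.mem_graph_iff]
  constructor
  · rintro ⟨y, rfl, e⟩
    refine ⟨y, rfl, ?_⟩
    change A y - w • (y : H) = f at e
    rw [← e, sub_add_cancel]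
  · rintro ⟨y, rfl, e⟩
    refine ⟨y, rfl, ?_⟩
    change A y - w • (y : H) = f
    rw [e, add_sub_cancel_right]

/-- Passing to graphs replaces domain membership proofs by pairs (u, f), so shifts of the operator
become shifts of the second entry. -/
theorem isBoundedInverse_iff {A : H →ₗ.[ℂ] H} {R : H →L[ℂ] H} :
    IsBoundedInverse A R ↔ (∀ f, (R f, f) ∈ A.graph) ∧ ∀ u f, (u, f) ∈ A.graph → R f = u := by
  simp only [LinearPMap.mem_graph_iff]
  refine and_congr (forall_congr' fun f => ⟨?_, ?_⟩) ⟨?_, ?_⟩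
  · rintro ⟨h, e⟩
    exact ⟨⟨_, h⟩, rfl, e⟩
  · rintro ⟨⟨_, h⟩, rfl, e⟩
    exact ⟨h, e⟩
  · rintro h _ _ ⟨u, rfl, rfl⟩
    exact h u
  · exact fun h u => h u _ ⟨u, rfl, rfl⟩

theorem isBoundedInverse_subScalar_iff {A : H →ₗ.[ℂ] H} {w : ℂ} {R : H →L[ℂ] H} :
    IsBoundedInverse (subScalar A w) R ↔ IsInverseSub A (w • 1) R := by
  simp only [isBoundedInverse_iff, mem_graph_subScalar, IsInverseSub]
  refine and_congr Iff.rfl ⟨fun h u g hg => h u _ ?_, fun h u f hf => ?_⟩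
  · simpa using hg
  · simpa using h u _ hf

theorem isBoundedInverse_subScalar_subScalar_iff {A : H →ₗ.[ℂ] H} {v w : ℂ} {R : H →L[ℂ] H} :
    IsBoundedInverse (subScalar (subScalar A v) w) R ↔ IsInverseSub A ((v + w) • 1) R := by
  rw [← isBoundedInverse_subScalar_iff]
  simp only [isBoundedInverse_iff, mem_graph_subScalar, add_smul, add_assoc, add_comm (w • _)]

/-- The second resolvent identity. -/
theorem IsInverseSub.add {A : H →ₗ.[ℂ] H} {B E R : H →L[ℂ] H} (h : IsInverseSub A B R)
    (hu : IsUnit (1 - E * R)) : IsInverseSub A (B + E) (R * Ring.inverse (1 - E * R)) := by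
  -- On the domain of A, R inverts A - B, hence A - B - E = (1 - E R)(A - B); both inverse
  -- identities follow from this factorization.
  set S := Ring.inverse (1 - E * R)
  refine ⟨fun f => ?_, fun u g hg => ?_⟩
  · have e : S f - E (R (S f)) = f := congr($(Ring.mul_inverse_cancel _ hu) f)
    have := h.1 (S f)
    have e' : f + (B + E) (R (S f)) = S f + B (R (S f)) := by
      nth_rewrite 1 [← e]
      rw [add_apply]
      abel
    change (R (S f), f + (B + E) (R (S f))) ∈ A.graph
    rwa [e']
  · have e : S ((g - B u) - E (R (g - B u))) = g - B u :=
      congr($(Ring.inverse_mul_cancel _ hu) (g - B u))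
    rw [h.2 u g hg] at e
    change R (S (g - (B + E) u)) = u
    rw [add_apply, ← sub_sub, e, h.2 u g hg]

theorem resolvent_eq {A : H →ₗ.[ℂ] H} {z : ℂ} {R : H →L[ℂ] H}
    (h : IsBoundedInverse (subScalar A z) R) : resolvent A z = R :=
  (resolvent_spec ⟨R, h⟩).unique h

end Perturbation

/-! ### Components of spinors -/

theorem comp_incl (i j : Fin 2) (u : L2) : comp i (incl j u) = if i = j then u else 0 := by
  have h1 := ContinuousLinearMap.coeFn_compLpL (p := 2) (μ := halfLine)
    (EuclideanSpace.proj i : EuclideanSpace ℂ (Fin 2) →L[ℂ] ℂ) (incl j u)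
  have h2 := ContinuousLinearMap.coeFn_compLpL (p := 2) (μ := halfLine)
    (ContinuousLinearMap.toSpanSingleton ℂ (EuclideanSpace.single j (1 : ℂ))) u
  refine Lp.ext (h1.trans ?_)
  split_ifs with hij
  · filter_upwards [h2] with x hx
    rw [incl, hx]
    simp [hij]
  · filter_upwards [h2, Lp.coeFn_zero ℂ 2 halfLine] with x hx h0
    rw [incl, hx, h0]
    simp [hij]

@[simp] theorem comp_zero_incl_zero (u : L2) : comp 0 (incl 0 u) = u := by simp [comp_incl]
@[simp] theorem comp_one_incl_one (u : L2) : comp 1 (incl 1 u) = u := by simp [comp_incl]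
@[simp] theorem comp_zero_incl_one (u : L2) : comp 0 (incl 1 u) = 0 := by simp [comp_incl]
@[simp] theorem comp_one_incl_zero (u : L2) : comp 1 (incl 0 u) = 0 := by simp [comp_incl]

theorem incl_comp_add (ψ : L2Spinor) : incl 0 (comp 0 ψ) + incl 1 (comp 1 ψ) = ψ := by
  have h1 (i : Fin 2) := ContinuousLinearMap.coeFn_compLpL (p := 2) (μ := halfLine)
    (EuclideanSpace.proj i : EuclideanSpace ℂ (Fin 2) →L[ℂ] ℂ) ψ
  have h2 (i : Fin 2) := ContinuousLinearMap.coeFn_compLpL (p := 2) (μ := halfLine)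
    (ContinuousLinearMap.toSpanSingleton ℂ (EuclideanSpace.single i (1 : ℂ))) (comp i ψ)
  refine Lp.ext ((Lp.coeFn_add _ _).trans ?_)
  filter_upwards [h1 0, h1 1, h2 0, h2 1] with x a b c d
  rw [Pi.add_apply, incl, incl, c, d, comp, comp, a, b]
  ext i
  fin_cases i <;> simp

theorem spinor_ext {ψ χ : L2Spinor} (h0 : comp 0 ψ = comp 0 χ) (h1 : comp 1 ψ = comp 1 χ) :
    ψ = χ := by
  rw [← incl_comp_add ψ, h0, h1, incl_comp_add]

/-! ### Weak derivatives -/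

theorem weakDeriv_eq {u : sobolevH1} {g : L2} (h : HasWeakDeriv u g) : weakDeriv u = g :=
  (weakDeriv_spec u).unique h

/-- Pairing with a compactly supported continuous function is an L² inner product, hence continuous
in L². -/
theorem tendsto_integral_smul {φ : ℝ → ℝ} (hc : Continuous φ) (hs : HasCompactSupport φ)
    {u : ℕ → L2} {v : L2} (h : Tendsto u atTop (𝓝 v)) :
    Tendsto (fun n => ∫ x in Ioi (0 : ℝ), φ x • u n x) atTop
      (𝓝 (∫ x in Ioi (0 : ℝ), φ x • v x)) := by
  have hm : MemLp (fun x => (φ x : ℂ)) 2 halfLine :=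
    ((hc.memLp_of_hasCompactSupport hs).restrict _).ofReal
  have key (w : L2) : ∫ x in Ioi (0 : ℝ), φ x • w x = inner ℂ hm.toLp w := by
    rw [L2.inner_def]
    refine integral_congr_ae ?_
    filter_upwards [hm.coeFn_toLp] with x hx
    rw [hx, RCLike.inner_apply, Complex.conj_ofReal, Complex.real_smul, mul_comm]
  simp only [key]
  exact tendsto_const_nhds.inner h

/-- The weak derivative is a closed operator. -/
theorem HasWeakDeriv.of_tendsto {u g : ℕ → L2} {v h : L2} (hu : Tendsto u atTop (𝓝 v))
    (hg : Tendsto g atTop (𝓝 h)) (hd : ∀ n, HasWeakDeriv (u n) (g n)) : HasWeakDeriv v h := by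
  intro φ hφ hs ht
  have h1 := tendsto_integral_smul (hφ.continuous_deriv (by simp)) hs.deriv hu
  have h2 := (tendsto_integral_smul hφ.continuous hs hg).neg
  refine tendsto_nhds_unique h1 (h2.congr fun n => ?_)
  exact (hd n φ hφ hs ht).symm

/-- A bounded operator with range in `H¹` is bounded as an operator into `H¹`. -/
theorem exists_hasWeakDeriv_clm (R : L2 →L[ℂ] L2) (h : ∀ f, R f ∈ sobolevH1) :
    ∃ V : L2 →L[ℂ] L2, ∀ f, HasWeakDeriv (R f) (V f) := by
  let V : L2 →ₗ[ℂ] L2 := weakDeriv ∘ₗ R.toLinearMap.codRestrict sobolevH1 h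
  have hV (f : L2) : HasWeakDeriv (R f) (V f) :=
    weakDeriv_spec (R.toLinearMap.codRestrict sobolevH1 h f)
  -- If uₙ → f and V uₙ → g, then R uₙ → R f, and closedness of the weak derivative identifies g
  -- with V f.
  refine ⟨⟨V, V.continuous_of_seq_closed_graph fun u f g hu hg => ?_⟩, hV⟩
  exact (HasWeakDeriv.of_tendsto ((R.continuous.tendsto f).comp hu) hg
    fun n => hV (u n)).unique (hV f)

/-! ### The graphs of the Dirac operator and of the Robin Laplacian -/

/-- `u` and `v` belong to `H¹`, with derivatives `u'` and `v'`, and `v(0) = b u(0)`. -/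
structure IsCoupledPair (b : ℂ) (u v u' v' : L2) : Prop where
  fst : HasWeakDeriv u u'
  snd : HasWeakDeriv v v'
  trace : ∃ a, HasTrace u a ∧ HasTrace v (b * a)

theorem IsCoupledPair.smul_snd {b : ℂ} {u v u' v' : L2} (h : IsCoupledPair b u v u' v') (k : ℂ) :
    IsCoupledPair (k * b) u (k • v) u' (k • v') := by
  obtain ⟨a, ha, hb⟩ := h.trace
  exact ⟨h.fst, h.snd.smul k, a, ha, by simpa [mul_assoc] using hb.smul k⟩

/-- Derivatives appear as explicit witnesses, which uniqueness of the weak derivative permits, so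
that equations for D_{0,c} become linear algebra in u, v, u', v'. -/
theorem mem_graph_dirac {α m c : ℝ} {ψ η : L2Spinor} :
    (ψ, η) ∈ (dirac α m c).graph ↔ ∃ u v u' v' : L2,
      IsCoupledPair ((Real.cot α / (m * c) : ℝ) : ℂ) u v u' v' ∧ ψ = incl 0 u + incl 1 v ∧
      η = incl 0 (((m * c ^ 2 : ℝ) : ℂ) • u - (c : ℂ) • v')
        + incl 1 ((c : ℂ) • u' - ((m * c ^ 2 : ℝ) : ℂ) • v) := by
  rw [LinearPMap.mem_graph_iff]
  constructor
  · rintro ⟨y, rfl, rfl⟩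
    obtain ⟨h0, h1, a, b, ha, hb, e⟩ := y.2
    exact ⟨_, _, _, _, ⟨weakDeriv_spec (diracComp α m c 0 y), weakDeriv_spec (diracComp α m c 1 y),
      a, ha, by rwa [mul_comm, e]⟩, (incl_comp_add _).symm, rfl⟩
  · rintro ⟨u, v, u', v', ⟨hu, hv, a, ha, hb⟩, rfl, rfl⟩
    have h0 : comp 0 (incl 0 u + incl 1 v) = u := by simp
    have h1 : comp 1 (incl 0 u + incl 1 v) = v := by simp
    have hd : incl 0 u + incl 1 v ∈ diracDomain α m c := by
      refine ⟨?_, ?_, a, _, by rwa [h0], by rwa [h1], mul_comm _ _⟩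
      · rw [h0]; exact ⟨_, hu⟩
      · rw [h1]; exact ⟨_, hv⟩
    refine ⟨⟨_, hd⟩, rfl, ?_⟩
    have e0 : weakDeriv (diracComp α m c 0 ⟨_, hd⟩) = u' := weakDeriv_eq (by
      change HasWeakDeriv (comp 0 (incl 0 u + incl 1 v)) u'; rwa [h0])
    have e1 : weakDeriv (diracComp α m c 1 ⟨_, hd⟩) = v' := weakDeriv_eq (by
      change HasWeakDeriv (comp 1 (incl 0 u + incl 1 v)) v'; rwa [h1])
    change incl 0 (((m * c ^ 2 : ℝ) : ℂ) • comp 0 (incl 0 u + incl 1 v)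
        - (c : ℂ) • weakDeriv (diracComp α m c 1 ⟨_, hd⟩))
      + incl 1 ((c : ℂ) • weakDeriv (diracComp α m c 0 ⟨_, hd⟩)
        - ((m * c ^ 2 : ℝ) : ℂ) • comp 1 (incl 0 u + incl 1 v)) = _
    rw [e0, e1, h0, h1]

/-- The Robin condition is the coupling condition for the pair (u, u'), so a coupled pair with v
proportional to u' passes directly between the Dirac and Robin problems. -/
theorem mem_graph_robin {m β : ℝ} {u f : L2} :
    (u, f) ∈ (robin m β).graph ↔ ∃ u' u'' : L2, IsCoupledPair (β : ℂ) u u' u' u'' ∧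
      f = (-((1 / (2 * m) : ℝ) : ℂ)) • u'' := by
  rw [LinearPMap.mem_graph_iff]
  constructor
  · rintro ⟨⟨_, y, ⟨a, b, ha, hb, rfl⟩, rfl⟩, rfl, rfl⟩
    exact ⟨_, _, ⟨weakDeriv_spec (Submodule.inclusion sobolevH2_le y),
      weakDeriv_spec (weakDerivH2 y), a, ha, hb⟩, rfl⟩
  · rintro ⟨u', u'', ⟨hu, hu', a, ha, hb⟩, rfl⟩
    have e1 : weakDeriv ⟨u, u', hu⟩ = u' := weakDeriv_eq hu
    have h2 : u ∈ sobolevH2 :=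
      ⟨⟨u, u', hu⟩, show weakDeriv ⟨u, u', hu⟩ ∈ sobolevH1 by rw [e1]; exact ⟨u'', hu'⟩, rfl⟩
    have e2 : (weakDerivH2 ⟨u, h2⟩ : L2) = u' := e1
    have hd : u ∈ robinDomain β :=
      ⟨⟨u, h2⟩, ⟨a, _, ha, show HasTrace (weakDerivH2 ⟨u, h2⟩ : L2) _ by rw [e2]; exact hb, rfl⟩,
        rfl⟩
    refine ⟨⟨u, hd⟩, rfl, ?_⟩
    change (-((1 / (2 * m) : ℝ) : ℂ)) • weakDeriv (weakDerivH2 ⟨u, h2⟩) = _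
    rw [weakDeriv_eq (u := weakDerivH2 ⟨u, h2⟩) (by rwa [e2])]

/-! ### The rescaled Dirac operator -/

/-- The operator `diag(a, b)` on `L²((0, ∞), ℂ²)`. -/
def diagScalar (a b : ℂ) : L2Spinor →L[ℂ] L2Spinor :=
  a • (incl 0).comp (comp 0) + b • (incl 1).comp (comp 1)

@[simp] theorem comp_zero_diagScalar (a b : ℂ) (ψ : L2Spinor) :
    comp 0 (diagScalar a b ψ) = a • comp 0 ψ := by simp [diagScalar]

@[simp] theorem comp_one_diagScalar (a b : ℂ) (ψ : L2Spinor) :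
    comp 1 (diagScalar a b ψ) = b • comp 1 ψ := by simp [diagScalar]

theorem diagScalar_add (a b a' b' : ℂ) :
    diagScalar a b + diagScalar a' b' = diagScalar (a + a') (b + b') := by
  simp only [diagScalar, add_smul]
  abel

theorem tendsto_diagScalar {ι : Type*} {l : Filter ι} {f g : ι → ℂ} {a b : ℂ}
    (hf : Tendsto f l (𝓝 a)) (hg : Tendsto g l (𝓝 b)) :
    Tendsto (fun i => diagScalar (f i) (g i)) l (𝓝 (diagScalar a b)) :=
  (hf.smul_const _).add (hg.smul_const _)

/-- Multiplying the second component by `c` turns `D_{0,c} - m c² - z` into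
`D_{0,1} - diag(m + z, m + z / c²)`. -/
theorem IsInverseSub.rescale {α m c : ℝ} (hc : c ≠ 0) {z : ℂ}
    {X : L2Spinor →L[ℂ] L2Spinor}
    (h : IsInverseSub (dirac α m 1) (diagScalar (m + z) (m + z / c ^ 2)) X) :
    IsInverseSub (dirac α m c) ((((m * c ^ 2 : ℝ) : ℂ) + z) • 1)
      (diagScalar 1 (c : ℂ)⁻¹ * X * diagScalar 1 (c : ℂ)⁻¹) := by
  have hc' : (c : ℂ) ≠ 0 := by exact_mod_cast hc
  refine ⟨fun f => ?_, fun ψ η hη => ?_⟩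
  · obtain ⟨u, v, u', v', hp, e1, e2⟩ := mem_graph_dirac.1 (h.1 (diagScalar 1 (c : ℂ)⁻¹ f))
    rw [e1] at e2
    have e3 := congrArg (comp 0) e2
    have e4 := congrArg (comp 1) e2
    simp only [map_add, comp_zero_incl_zero, comp_zero_incl_one, comp_one_incl_zero,
      comp_one_incl_one, comp_zero_diagScalar, comp_one_diagScalar, zero_add, add_zero,
      smul_zero] at e3 e4
    -- Dividing v by c turns the trace coefficient cot α / m into cot α / (mc).
    refine mem_graph_dirac.2 ⟨u, (c : ℂ)⁻¹ • v, u', (c : ℂ)⁻¹ • v', ?_, ?_, ?_⟩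
    · convert hp.smul_snd (c : ℂ)⁻¹ using 1
      push_cast
      field_simp
    · simp only [mul_apply_eq_comp, e1]
      apply spinor_ext <;> simp
    · simp only [mul_apply_eq_comp, e1]
      apply spinor_ext
      · simp [-Complex.coe_smul]
        linear_combination (norm := skip) e3
        match_scalars <;> field_simp <;> ring
      · simp [-Complex.coe_smul]
        -- The second row of the original equation is c times the second row of the rescaled one.
        linear_combination (norm := skip) (c : ℂ) • e4
        match_scalars <;> field_simp <;> ring
  · obtain ⟨u, v, u', v', hp, rfl, rfl⟩ := mem_graph_dirac.1 hη
    have := h.2 _ _ (mem_graph_dirac.2 ⟨u, (c : ℂ) • v, u', (c : ℂ) • v', ?_, rfl, rfl⟩)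
    · have e : diagScalar 1 (c : ℂ)⁻¹ (incl 0 (((m * c ^ 2 : ℝ) : ℂ) • u - (c : ℂ) • v')
          + incl 1 ((c : ℂ) • u' - ((m * c ^ 2 : ℝ) : ℂ) • v)
          - ((((m * c ^ 2 : ℝ) : ℂ) + z) • (1 : L2Spinor →L[ℂ] L2Spinor)) (incl 0 u + incl 1 v))
          = incl 0 (((m * 1 ^ 2 : ℝ) : ℂ) • u - ((1 : ℝ) : ℂ) • (c : ℂ) • v')
          + incl 1 (((1 : ℝ) : ℂ) • u' - ((m * 1 ^ 2 : ℝ) : ℂ) • (c : ℂ) • v)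
          - diagScalar (m + z) (m + z / c ^ 2) (incl 0 u + incl 1 ((c : ℂ) • v)) := by
        apply spinor_ext
        · simp [-Complex.coe_smul]
          module
        · simp [-Complex.coe_smul]
          match_scalars <;> field_simp
      rw [mul_apply_eq_comp, mul_apply_eq_comp, e, this]
      apply spinor_ext <;> simp [-Complex.coe_smul, smul_smul, hc']
    · convert hp.smul_snd (c : ℂ) using 1
      push_cast
      field_simp

/-- The formal limit `D_{0,1} - diag(m + z, m)` of the rescaled Dirac operators is invertible
for `z ∈ ρ(S₀)`. -/
theorem exists_isInverseSub_dirac {α m : ℝ} (hm : 0 < m) {z : ℂ} {R : L2 →L[ℂ] L2}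
    (hR : IsBoundedInverse (subScalar (robin m (2 * Real.cot α)) z) R) :
    ∃ X : L2Spinor →L[ℂ] L2Spinor, IsInverseSub (dirac α m 1) (diagScalar (m + z) m) X ∧
      diagScalar 1 0 * X * diagScalar 1 0 = diagZero R := by
  rw [isBoundedInverse_subScalar_iff] at hR
  have hm' : (m : ℂ) ≠ 0 := by exact_mod_cast hm.ne'
  have hμ : 0 < 2 * m := by positivity
  obtain ⟨V, hV⟩ := exists_hasWeakDeriv_clm R fun f => by
    obtain ⟨u', u'', hp, -⟩ := mem_graph_robin.1 (hR.1 f)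
    exact ⟨u', hp.fst⟩
  -- The rate 2m is the coefficient of v in u' - 2mv = g: with p = Q g and v = r'/(2m) - p, the
  -- terms p' + 2mp add up to g.
  let Q := decayOp hμ
  -- K is the right-hand side of the Robin problem for r: f - p' + zp, with p' = g - 2mp
  -- substituted.
  let K : L2Spinor →L[ℂ] L2 := comp 0 - comp 1 + (2 * m + z) • Q.comp (comp 1)
  let X : L2Spinor →L[ℂ] L2Spinor := (incl 0).comp (Q.comp (comp 1) + R.comp K)
    + (incl 1).comp ((2 * m : ℂ)⁻¹ • V.comp K - Q.comp (comp 1))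
  have hX (f : L2Spinor) : X f = incl 0 (Q (comp 1 f) + R (K f))
    + incl 1 ((2 * m : ℂ)⁻¹ • V (K f) - Q (comp 1 f)) := rfl
  have hK (f : L2Spinor) : K f = comp 0 f - comp 1 f + (2 * m + z) • Q (comp 1 f) := rfl
  have right (f : L2Spinor) :
      (X f, f + diagScalar (m + z) m (X f)) ∈ (dirac α m 1).graph := by
    obtain ⟨u', u'', hp, e⟩ := mem_graph_robin.1 (hR.1 (K f))
    obtain rfl : u' = V (K f) := hp.fst.unique (hV _)
    obtain ⟨a, ha, hb⟩ := hp.trace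
    have hQ := hasWeakDeriv_decayOp hμ (comp 1 f)
    have hQ0 := hasTrace_decayOp hμ (comp 1 f)
    refine mem_graph_dirac.2 ⟨_, _, _, _, ⟨hQ.add hp.fst,
      (hp.snd.smul (2 * m : ℂ)⁻¹).add (hQ.smul (-1)), 0 + a, hQ0.add ha, ?_⟩, ?_, ?_⟩
    · convert (hb.smul (2 * m : ℂ)⁻¹).add (hQ0.smul (-1)) using 1
      push_cast
      field_simp
      ring
    · rw [hX, neg_one_smul, sub_eq_add_neg]
    · rw [hX]
      apply spinor_ext
      · have e5 : K f + z • R (K f) = -((1 / (2 * m) : ℝ) : ℂ) • u'' := e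
        have e6 : comp 0 f = K f + comp 1 f - (2 * m + z) • Q (comp 1 f) := by
          rw [hK]
          abel
        simp only [map_add, comp_zero_incl_zero, comp_zero_incl_one, comp_zero_diagScalar, add_zero,
          e6]
        linear_combination (norm := skip) e5
        match_scalars <;> field_simp <;> ring
      · simp only [map_add, comp_one_incl_zero, comp_one_incl_one, comp_one_diagScalar, zero_add]
        match_scalars <;> field_simp <;> ring
  refine ⟨X, ⟨right, fun ψ η hη => ?_⟩, ?_⟩
  · set f := η - diagScalar (m + z) m ψ with hf
    -- X f and ψ solve the same equation, so their difference (u, v) lies in the kernel and it is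
    -- enough to show that the kernel is trivial.
    have hχ := (dirac α m 1).graph.sub_mem (right f) hη
    rw [Prod.mk_sub_mk] at hχ
    obtain ⟨u, v, u', v', hp, e1, e2⟩ := mem_graph_dirac.1 hχ
    clear_value f
    have e : f + diagScalar (m + z) m (X f) - η = diagScalar (m + z) m (incl 0 u + incl 1 v) := by
      rw [← e1, map_sub]
      rw [sub_eq_iff_eq_add.1 hf.symm]
      abel
    rw [e] at e2
    have e3 := congrArg (comp 0) e2
    have e4 := congrArg (comp 1) e2
    simp [-Complex.coe_smul] at e3 e4
    have hv' : v' = -z • u := by linear_combination (norm := module) e3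
    have hu' : u' = (2 * m : ℂ) • v := by linear_combination (norm := module) -e4
    -- The kernel equations v' = -zu, u' = 2mv and the coupled traces say that S₀ u = z u; since z ∈
    -- ρ(S₀), this forces u = 0, and then v = 0.
    have hg : (u, z • u) ∈ (robin m (2 * Real.cot α)).graph := by
      refine mem_graph_robin.2 ⟨u', (2 * m : ℂ) • v', ⟨hp.fst, hu' ▸ hp.snd.smul _, ?_⟩, ?_⟩
      · obtain ⟨a, ha, hb⟩ := hp.trace
        refine ⟨a, ha, ?_⟩
        rw [hu']
        convert hb.smul (2 * m : ℂ) using 1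
        push_cast
        field_simp
      · rw [hv']
        match_scalars
        field_simp
    have hu : u = 0 := by simpa using (hR.2 _ _ hg).symm
    have hv : v = 0 := by
      have : u' = 0 := (hu ▸ hp.fst).unique HasWeakDeriv.zero
      rw [this] at hu'
      simpa [hm'] using hu'.symm
    rw [hu, hv, map_zero, map_zero, add_zero] at e1
    exact sub_eq_zero.1 e1
  · ext1 f
    simp only [mul_apply_eq_comp]
    -- With second component zero, p vanishes and K reduces to the first component, leaving r = R f.
    apply spinor_ext <;> simp [hX, hK, diagZero]

/-! ### Vanishing perturbations in a Banach algebra -/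

/-- Inversion is continuous at the unit 1, and 1 - E X → 1. -/
theorem tendsto_mul_inverse_one_sub_mul {A ι : Type*} [NormedRing A] [CompleteSpace A]
    {l : Filter ι} {W E : ι → A} {W₀ X : A} (hW : Tendsto W l (𝓝 W₀)) (hE : Tendsto E l (𝓝 0)) :
    Tendsto (fun i => W i * (X * Ring.inverse (1 - E i * X)) * W i) l (𝓝 (W₀ * X * W₀)) := by
  have hEX : Tendsto (fun i => 1 - E i * X) l (𝓝 1) := by
    simpa using (hE.mul_const X).const_sub 1
  have hi := (NormedRing.inverse_continuousAt (1 : Aˣ)).tendsto.comp hEX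
  rw [Units.val_one, Ring.inverse_one] at hi
  simpa [Function.comp_def] using (hW.mul (hi.const_mul X)).mul hW

theorem eventually_isUnit_one_sub_mul {A ι : Type*} [NormedRing A] [CompleteSpace A]
    {l : Filter ι} {E : ι → A} {X : A} (hE : Tendsto E l (𝓝 0)) :
    ∀ᶠ i in l, IsUnit (1 - E i * X) := by
  have hEX : Tendsto (fun i => 1 - E i * X) l (𝓝 1) := by
    simpa using (hE.mul_const X).const_sub 1
  exact hEX.eventually (Units.isOpen.mem_nhds isUnit_one)

end NonRelLimit

end

/-! ### The non-relativistic limit -/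

open NonRelLimit in
theorem theorem5p1 (α m : ℝ) (hα : α ∈ Ioo 0 (Real.pi / 2)) (hm : 0 < m) (z : ℂ)
    (hz : z ∈ NonRelLimit.resolventSet (NonRelLimit.robin m (2 * Real.cot α))) :
    (∀ᶠ c : ℝ in atTop, z ∈ NonRelLimit.resolventSet
      (NonRelLimit.subScalar (NonRelLimit.dirac α m c) ((m * c ^ 2 : ℝ) : ℂ))) ∧
    Tendsto (fun c : ℝ =>
      ‖NonRelLimit.resolvent
          (NonRelLimit.subScalar (NonRelLimit.dirac α m c) ((m * c ^ 2 : ℝ) : ℂ)) z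
        - NonRelLimit.diagZero
          (NonRelLimit.resolvent (NonRelLimit.robin m (2 * Real.cot α)) z)‖)
      atTop (𝓝 0) := by
  obtain ⟨X, hX, hXR⟩ := exists_isInverseSub_dirac hm (resolvent_spec hz)
  -- E is the difference between diag(m+z, m+z/c²) and its formal limit diag(m+z, m); Y below is the
  -- resolvent for large c, obtained by perturbing X by E and undoing the rescaling.
  let E (c : ℝ) : L2Spinor →L[ℂ] L2Spinor := diagScalar 0 (z / (c : ℂ) ^ 2)
  let W (c : ℝ) : L2Spinor →L[ℂ] L2Spinor := diagScalar 1 (c : ℂ)⁻¹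
  let Y (c : ℝ) := W c * (X * Ring.inverse (1 - E c * X)) * W c
  have hinv : Tendsto (fun c : ℝ => (c : ℂ)⁻¹) atTop (𝓝 0) := by
    simpa [Function.comp_def] using
      (Complex.continuous_ofReal.tendsto 0).comp (tendsto_inv_atTop_zero (𝕜 := ℝ))
  have hW : Tendsto W atTop (𝓝 (diagScalar 1 0)) :=
    tendsto_diagScalar tendsto_const_nhds hinv
  have hE : Tendsto E atTop (𝓝 0) := by
    have h0 : diagScalar 0 0 = 0 := by simp [diagScalar]
    have h1 : Tendsto (fun c : ℝ => z / (c : ℂ) ^ 2) atTop (𝓝 0) := by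
      simpa [div_eq_mul_inv] using (hinv.pow 2).const_mul z
    rw [← h0]
    exact tendsto_diagScalar tendsto_const_nhds h1
  have hY : Tendsto Y atTop (𝓝 (diagZero (resolvent (robin m (2 * Real.cot α)) z))) := by
    rw [← hXR]
    exact tendsto_mul_inverse_one_sub_mul hW hE
  have key : ∀ᶠ c : ℝ in atTop,
      IsBoundedInverse (subScalar (subScalar (dirac α m c) ((m * c ^ 2 : ℝ) : ℂ)) z) (Y c) := by
    filter_upwards [eventually_isUnit_one_sub_mul (X := X) hE, eventually_ne_atTop 0]
      with c hu hc
    rw [isBoundedInverse_subScalar_subScalar_iff]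
    refine IsInverseSub.rescale hc ?_
    have h := hX.add hu
    rwa [diagScalar_add, add_zero] at h
  refine ⟨key.mono fun c h => ⟨_, h⟩, ?_⟩
  refine (tendsto_iff_norm_sub_tendsto_zero.1 hY).congr' ?_
  filter_upwards [key] with c h
  rw [resolvent_eq h]
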